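/- Let $\Lambda\subset\mathbb R$ be a countable set that has an integral basis, i.e. the $\mathbb Q$-vector space $V\subset\mathbb R$ spanned by $\Lambda$ has a basis $\mathbf g=(g_k)_{k\in K}$ ($K$ finite or countable) such that every $\lambda\in\Lambda$ is a finite combination $\lambda=\sum_k r_{\lambda,k}g_k$ with $r_{\lambda,k}\in\mathbb Z$; write $\langle \mathbf r_\lambda,\mathbf x\rangle=\sum_k r_{\lambda,k}x_k$ for $\mathbf x\in\mathbb R^K$. Let $U=\{s\in\mathbb C:\alpha<\operatorname{Re}s<\beta\}$ with $-\infty\le\alpha<\beta\le\infty$. A function $f:U\to\mathbb C$ is almost periodic in $U$ if on every reduced strip $\{\sigma_1\le\operatorname{Re}s\le\sigma_2\}$, $\alpha<\sigma_1\le\sigma_2<\beta$, it is a uniform limit of exponential polynomials $\sum_{j=1}^m c_je^{\mu_js}$ with $c_j\in\mathbb C$, $\mu_j\in\mathbb R$. Its Dirichlet coefficient at $\mu\in\mathbb R$ is $\lim_{T\to\infty}\frac1{2T}\int_{-T}^{T}f(\sigma+it)e^{-\mu(\sigma+it)}\,dt$, for any $\sigma\in(\alpha,\beta)$. Let $\mathcal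 D_\Lambda$ be the set of the almost periodic functions in $U$ whose Dirichlet coefficients vanish at every $\mu\notin\Lambda$; such an $f$ has the Dirichlet series $\sum_{\lambda\in\Lambda}a_\lambda e^{\lambda s}$, where $a_\lambda$ is its coefficient at $\lambda$. Two functions in $\mathcal D_\Lambda$ with coefficients $(a_\lambda)$ and $(b_\lambda)$ are equivalent, written $\sim$, if there is a $\mathbb Q$-linear map $\psi:V\to\mathbb R$ with $b_\lambda=a_\lambda e^{i\psi(\lambda)}$ for all $\lambda\in\Lambda$. For $f\in\mathcal D_\Lambda$ with coefficients $(a_\lambda)$, the auxiliary function relative to the integral basis $\mathbf g$ is $$F_f(\sigma,\mathbf x)=\sum_{\lambda\in\Lambda}a_\lambda e^{\lambda\sigma}e^{i\langle\mathbf r_\lambda,\mathbf x\rangle},\qquad \sigma\in(\alpha,\beta),\ \mathbf x\in\mathbb R^{K},$$ where the series is summed by the Bochner–Fejér procedure: it is the limit of the finite sums $$\sum_{\lambda}\ \prod_{k\in I}\max\Bigl(0,1-\frac{|r_{\lambda,k}|}{N_k}\Bigr)\,a_\lambda e^{\lambda\sigma}e^{i\langle\mathbf r_\lambda,\mathbf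 x\rangle},$$ over those $\lambda\in\Lambda$ with $r_{\lambda,k}=0$ for all $k\notin I$, as the finite sets $I\subset K$ exhaust $K$ and each order $N_k\ge1$ tends to infinity. Let $f\in\mathcal D_\Lambda$ and $\sigma_0\in(\alpha,\beta)$. Put $\operatorname{Img}(h(\sigma_0+it))=\{h(\sigma_0+it):t\in\mathbb R\}$ for $h:U\to\mathbb C$. Then: (i) If $f_1\sim f$, then $\operatorname{Img}(f_1(\sigma_0+it))\subset\overline{\operatorname{Img}(f(\sigma_0+it))}$ and $\overline{\operatorname{Img}(f(\sigma_0+it))}=\overline{\operatorname{Img}(f_1(\sigma_0+it))}$. (ii) For every integral basis of $\Lambda$, the limit defining $F_f(\sigma_0,\mathbf x)$ exists for every $\mathbf x$, and $$\{F_f(\sigma_0,\mathbf x):\mathbf x\in\mathbb R^{K}\}=\bigcup_{f_k\sim f}\operatorname{Img}(f_k(\sigma_0+it)).$$ -/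

import Mathlib

open Filter Topology

noncomputable section

/-- The exponential polynomial `∑ c(l) e^{l s}` with finitely many real exponents `l`. -/
def expPoly (c : ℝ →₀ ℂ) (s : ℂ) : ℂ :=
  c.sum fun l z => z * Complex.exp (l * s)

/-- `f ∈ AP(U, ℂ)` for the strip `U = {α < Re s < β}`: on every reduced strip
`{σ₁ ≤ Re s ≤ σ₂}` of `U` the function `f` is a uniform limit of exponential polynomials with
complex coefficients and real exponents. -/
def IsAlmostPeriodicOn (α β : EReal) (f : ℂ → ℂ) : Prop :=
  ∀ σ₁ σ₂ : ℝ, α < (σ₁ : EReal) → (σ₂ : EReal) < β → ∀ ε : ℝ, 0 < ε →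
    ∃ c : ℝ →₀ ℂ, ∀ s : ℂ, σ₁ ≤ s.re → s.re ≤ σ₂ → ‖f s - expPoly c s‖ < ε

/-- `c` is the Dirichlet coefficient of `f` at the exponent `l`: for every `σ ∈ (α, β)`,
`c = lim_{T → ∞} (1 / 2T) ∫_{-T}^{T} f(σ + it) e^{-l (σ + it)} dt`. -/
def HasDirichletCoeff (α β : EReal) (f : ℂ → ℂ) (l : ℝ) (c : ℂ) : Prop :=
  ∀ σ : ℝ, α < (σ : EReal) → (σ : EReal) < β →
    Tendsto (fun T : ℝ => ((2 * T : ℝ) : ℂ)⁻¹ *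
        ∫ t in (-T)..T, f (σ + t * Complex.I) * Complex.exp (-(l * (σ + t * Complex.I))))
      atTop (𝓝 c)

/-- The Dirichlet series of `f` is `∑_{l ∈ Λ} a(l) e^{l s}`; zero coefficients `a(l)` are
allowed, and every exponent outside `Λ` has coefficient `0`. -/
def HasDirichletSeries (α β : EReal) {Λ : Set ℝ} (f : ℂ → ℂ) (a : Λ → ℂ) : Prop :=
  (∀ l : Λ, HasDirichletCoeff α β f l (a l)) ∧
    ∀ l : ℝ, l ∉ Λ → HasDirichletCoeff α β f l 0

/-- The functions of the class `𝓓_Λ` whose strip of almost periodicity is `{α < Re s < β}`. -/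
def classD (Λ : Set ℝ) (α β : EReal) : Set (ℂ → ℂ) :=
  {f | IsAlmostPeriodicOn α β f ∧ ∃ a : Λ → ℂ, HasDirichletSeries α β f a}

/-- `a ∼ b` for `a, b : Λ → ℂ`: there is a `ℚ`-linear map `ψ` from the `ℚ`-span of `Λ` to `ℝ`
with `b(l) = a(l) e^{i ψ(l)}` for all `l ∈ Λ`. -/
def CoeffEquiv {Λ : Set ℝ} (a b : Λ → ℂ) : Prop :=
  ∃ ψ : Submodule.span ℚ Λ →ₗ[ℚ] ℝ, ∀ l : Λ,
    b l = a l * Complex.exp (Complex.I * (ψ ⟨(l : ℝ), Submodule.subset_span l.2⟩ : ℂ))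

/-- `f₁ ∼ f₂`: both functions belong to `𝓓_Λ` on the strip `{α < Re s < β}`, and the coefficients
of their Dirichlet series are equivalent. -/
def BohrEquiv (Λ : Set ℝ) (α β : EReal) (f₁ f₂ : ℂ → ℂ) : Prop :=
  f₁ ∈ classD Λ α β ∧ f₂ ∈ classD Λ α β ∧
    ∃ a b : Λ → ℂ, HasDirichletSeries α β f₁ a ∧ HasDirichletSeries α β f₂ b ∧ CoeffEquiv a b

/-- An integral basis of `Λ`, indexed by `ι`: a basis `g` of the `ℚ`-vector space spanned by `Λ`
such that every `l ∈ Λ` is a finite combination `l = ∑ k, r_{l,k} g_k` with integers `r_{l,k}`.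
(The vector `r_l = coord l` is determined by `g`.) -/
structure IntegralBasis (Λ : Set ℝ) (ι : Type*) where
  g : ι → ℝ
  linearIndependent : LinearIndependent ℚ g
  span_eq : Submodule.span ℚ (Set.range g) = Submodule.span ℚ Λ
  coord : Λ → ι →₀ ℤ
  coord_sum : ∀ l : Λ, ((coord l).sum fun k r => (r : ℝ) * g k) = (l : ℝ)

namespace IntegralBasis

variable {Λ : Set ℝ} {ι : Type*} (G : IntegralBasis Λ ι)

/-- The pairing `⟨r_l, x⟩ = ∑ k, r_{l,k} x_k` (a finite sum). -/
def pairing (l : Λ) (x : ι → ℝ) : ℝ :=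
  (G.coord l).sum fun k r => (r : ℝ) * x k

open Classical in
/-- The Bochner-Fejér multiplier of the exponent `l = ∑ k, r_k g_k` for the finitely many basis
elements `g_k`, `k ∈ I`, and the orders `N_k = n_k + 1`: it is `∏_{k ∈ I} (1 - |r_k| / N_k)` if
`l` involves only these basis elements and `|r_k| ≤ N_k` for all `k ∈ I`, and `0` otherwise. -/
def fejerWeight (I : Finset ι) (n : ι → ℕ) (l : Λ) : ℝ :=
  if (G.coord l).support ⊆ I then
    ∏ k ∈ I, max 0 (1 - |(G.coord l k : ℝ)| / ((n k : ℝ) + 1))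
  else 0

/-- The Bochner-Fejér polynomial, with basis elements `I` and orders `n + 1`, of the exponential
sum `∑_{l ∈ Λ} c(l) e^{l s}`. The sum has finitely many nonzero terms, see
`finite_support_fejerWeight`. -/
def bochnerFejerPoly (c : Λ → ℂ) (I : Finset ι) (n : ι → ℕ) (s : ℂ) : ℂ :=
  ∑ᶠ l : Λ, (G.fejerWeight I n l : ℂ) * c l * Complex.exp ((l : ℝ) * s)

/-- The filter along which Bochner-Fejér polynomials are taken: the finite sets `I` exhaust the
index set of the basis, and each single order `n k` tends to infinity. -/
def fejerFilter (ι : Type*) : Filter (Finset ι × (ι → ℕ)) :=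
  atTop ×ˢ Filter.pi fun _ : ι => (atTop : Filter ℕ)

/-- `∑_{l ∈ Λ} c(l) e^{l s}`, summed by the Bochner-Fejér procedure at the point `s`, has the
sum `w`. -/
def BochnerFejerSummable (c : Λ → ℂ) (s w : ℂ) : Prop :=
  Tendsto (fun p : Finset ι × (ι → ℕ) => G.bochnerFejerPoly c p.1 p.2 s) (fejerFilter ι) (𝓝 w)

/-- The coefficients of the exponential sum `∑ a(l) e^{i ⟨r_l, x⟩} e^{l s}`. -/
def twist (a : Λ → ℂ) (x : ι → ℝ) (l : Λ) : ℂ :=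
  a l * Complex.exp (Complex.I * (G.pairing l x : ℂ))

/-- The auxiliary function `F(σ, x) = ∑_{l ∈ Λ} a(l) e^{l σ} e^{i ⟨r_l, x⟩}`, relative to the
integral basis `G`, where the series is the Bochner-Fejér sum at `t = 0` of the exponential sum
`∑ a(l) e^{i ⟨r_l, x⟩} e^{l s}`, `s = σ + it`. -/
def auxFun (a : Λ → ℂ) (σ : ℝ) (x : ι → ℝ) : ℂ :=
  limUnder (fejerFilter ι)
    fun p : Finset ι × (ι → ℕ) => G.bochnerFejerPoly (G.twist a x) p.1 p.2 (σ : ℂ)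

theorem finite_support_fejerWeight (I : Finset ι) (n : ι → ℕ) :
    {l : Λ | G.fejerWeight I n l ≠ 0}.Finite := by
  classical
  have hinj : Function.Injective G.coord := by
    intro l m h
    apply Subtype.ext
    rw [← G.coord_sum l, ← G.coord_sum m, h]
  let b : ι →₀ ℤ := Finsupp.indicator I fun k _ => (n k : ℤ) + 1
  refine ((Set.finite_Icc (-b) b).preimage hinj.injOn).subset ?_
  intro l hl
  change G.fejerWeight I n l ≠ 0 at hl
  unfold fejerWeight at hl
  split_ifs at hl with hsub
  · rw [Finset.prod_ne_zero_iff] at hl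
    have key : ∀ k, |G.coord l k| ≤ b k := by
      intro k
      by_cases hk : k ∈ I
      · have h1 := hl k hk
        have hpos : (0 : ℝ) < (n k : ℝ) + 1 := by positivity
        have h2 : 0 < 1 - |(G.coord l k : ℝ)| / ((n k : ℝ) + 1) := by
          by_contra h
          exact h1 (max_eq_left (not_lt.mp h))
        have h3 : |(G.coord l k : ℝ)| ≤ (n k : ℝ) + 1 := by
          have := (div_lt_one hpos).mp (sub_pos.mp h2)
          exact this.le
        have h4 : b k = (n k : ℤ) + 1 := by simp [b, hk]
        rw [h4]
        exact_mod_cast h3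
      · have h0 : G.coord l k = 0 := by
          by_contra h
          exact hk (hsub (Finsupp.mem_support_iff.mpr h))
        simp [h0, b, hk]
    refine ⟨fun k => ?_, fun k => ?_⟩
    · simpa using (abs_le.mp (key k)).1
    · exact (abs_le.mp (key k)).2
  · exact absurd rfl hl

end IntegralBasis

/-- `Img(f(σ₀ + it))`: the set of values of `f` on the line `Re s = σ₀`. -/
def lineImage (f : ℂ → ℂ) (σ₀ : ℝ) : Set ℂ :=
  {w : ℂ | ∃ t : ℝ, w = f (σ₀ + t * Complex.I)}

/-- `Img(F_f(σ₀, x))`: the set of values of the auxiliary function at `σ = σ₀`. -/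
def auxImage {Λ : Set ℝ} {ι : Type*} (G : IntegralBasis Λ ι) (a : Λ → ℂ) (σ₀ : ℝ) : Set ℂ :=
  {w : ℂ | ∃ x : ι → ℝ, w = G.auxFun a σ₀ x}

end

noncomputable section

/-! ### Mean values -/

/-! A `ℚ`-linear `Ψ : ℝ → ℝ` gives the character `l ↦ e^{iΨ(l)}`, and equivalence of functions means
multiplying coefficients by such a character. Multiplication by `t` as `Ψ` is the vertical
translation by `t`; a point `x` is the family of values `Ψ (g k)`.

The engine is positivity. A product of Fejér kernels over rationally independent frequencies is
nonnegative at every character and has mean 1. Convolving a bounded function on the line with such a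
kernel shifted by any character, not only by a real number, keeps its bound
(`IsPosKernel.norm_charSum_le`).

This has two consequences. The supremum of an exponential sum over all characters is its supremum
over the line, which yields Kronecker's theorem (`exists_forall_norm_exp_sub_le`). And if a
polynomial `q` with frequencies in `Λ` approximates `f`, the Bochner-Fejér sums of the twisted
series of `f` eventually stay close to the twist of `q`; so they converge, to a function
approximated by twists of the approximants of `f` (`IntegralBasis.exists_isTwist`). With `Ψ = 0`
this gives uniqueness of Dirichlet series.

For (i), Kronecker moves a value of the twisted `q` to a nearby value of `q` on the line; the
inverse character gives the reverse inclusion. For (ii), values of the auxiliary function are values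
of twists at `σ₀`, and moving by `t` along the line replaces `Ψ` by `Ψ + t·`. -/

/-- The mean value `lim_{T → ∞} (1 / 2T) ∫_{-T}^{T} h` exists and is equal to `c`. -/
def HasMean (h : ℝ → ℂ) (c : ℂ) : Prop :=
  Tendsto (fun T : ℝ => ((2 * T : ℝ) : ℂ)⁻¹ * ∫ t in (-T)..T, h t) atTop (𝓝 c)

namespace HasMean

variable {h k : ℝ → ℂ} {c d : ℂ}

theorem add (hh : HasMean h c) (hk : HasMean k d) (h_cont : Continuous h) (k_cont : Continuous k) :
    HasMean (fun t => h t + k t) (c + d) := by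
  refine (Tendsto.add hh hk).congr fun T => ?_
  rw [intervalIntegral.integral_add (h_cont.intervalIntegrable _ _) (k_cont.intervalIntegrable _ _)]
  ring

theorem const_mul (hh : HasMean h c) (z : ℂ) : HasMean (fun t => z * h t) (z * c) := by
  refine (Tendsto.const_mul z hh).congr fun T => ?_
  rw [intervalIntegral.integral_const_mul]
  ring

theorem zero : HasMean (fun _ => 0) 0 := by
  simp [HasMean]

theorem sum {ι : Type*} (s : Finset ι) {h : ι → ℝ → ℂ} {c : ι → ℂ}
    (hh : ∀ i ∈ s, HasMean (h i) (c i)) (h_cont : ∀ i ∈ s, Continuous (h i)) :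
    HasMean (fun t => ∑ i ∈ s, h i t) (∑ i ∈ s, c i) := by
  classical
  induction s using Finset.induction_on with
  | empty => simpa using zero
  | insert i s hi ih =>
    simp only [Finset.sum_insert hi]
    refine (hh i (by simp)).add (ih (fun j hj => hh j (by simp [hj]))
      fun j hj => h_cont j (by simp [hj])) (h_cont i (by simp)) ?_
    exact continuous_finsetSum _ fun j hj => h_cont j (by simp [hj])

theorem norm_le (hh : HasMean h c) {b : ℝ → ℝ} (b_cont : Continuous b)
    (hb : HasMean (fun t => (b t : ℂ)) d) (h_le : ∀ t, ‖h t‖ ≤ b t) : ‖c‖ ≤ ‖d‖ := by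
  refine le_of_tendsto_of_tendsto (Tendsto.norm hh) (Tendsto.norm hb) ?_
  filter_upwards [eventually_gt_atTop 0] with T hT
  rw [norm_mul, norm_mul]
  refine mul_le_mul_of_nonneg_left ?_ (norm_nonneg _)
  refine (intervalIntegral.norm_integral_le_of_norm_le (by linarith)
    (Eventually.of_forall fun t _ => h_le t) (b_cont.intervalIntegrable _ _)).trans ?_
  rw [intervalIntegral.integral_ofReal, Complex.norm_real]
  exact le_abs_self _

end HasMean

theorem hasMean_const (z : ℂ) : HasMean (fun _ => z) z := by
  refine tendsto_const_nhds.congr' ?_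
  filter_upwards [eventually_gt_atTop 0] with T hT
  have : (T : ℂ) ≠ 0 := by exact_mod_cast hT.ne'
  rw [intervalIntegral.integral_const, Complex.real_smul]
  push_cast
  field_simp
  ring

theorem hasMean_exp (μ : ℝ) :
    HasMean (fun t => Complex.exp (Complex.I * (μ * t : ℝ))) (if μ = 0 then 1 else 0) := by
  split_ifs with h
  · simpa [h] using hasMean_const 1
  have hμ : Complex.I * (μ : ℂ) ≠ 0 := by simp [h]
  have key : ∀ T : ℝ, (∫ t in (-T)..T, Complex.exp (Complex.I * (μ * t : ℝ))) =
      (Complex.exp (((μ * T : ℝ) : ℂ) * Complex.I) -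
        Complex.exp (((-(μ * T) : ℝ) : ℂ) * Complex.I)) / (Complex.I * μ) := by
    intro T
    have := integral_exp_mul_complex (a := -T) (b := T) hμ
    push_cast at this ⊢
    ring_nf at this ⊢
    exact this
  rw [HasMean, tendsto_zero_iff_norm_tendsto_zero]
  have hlim : Tendsto (fun T : ℝ => (2 / |μ|) * |2 * T|⁻¹) atTop (𝓝 0) := by
    have : Tendsto (fun T : ℝ => |2 * T|) atTop atTop :=
      tendsto_abs_atTop_atTop.comp (tendsto_id.const_mul_atTop (by norm_num))
    simpa using this.inv_tendsto_atTop.const_mul (2 / |μ|)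
  refine squeeze_zero (fun _ => norm_nonneg _) (fun T => ?_) hlim
  rw [key, norm_mul, norm_inv, norm_div, norm_mul, Complex.norm_I, one_mul, Complex.norm_real,
    Complex.norm_real, mul_comm, Real.norm_eq_abs, Real.norm_eq_abs]
  refine mul_le_mul_of_nonneg_right ?_ (by positivity)
  refine div_le_div_of_nonneg_right ((norm_sub_le _ _).trans ?_) (abs_nonneg _)
  rw [Complex.norm_exp_ofReal_mul_I, Complex.norm_exp_ofReal_mul_I]
  norm_num

/-! ### Exponential sums twisted by additive characters -/

/-- The value of `∑ q(l) e^{i Φ(l)}` at the `ℚ`-linear map `Φ`. -/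
def charSum (q : ℝ →₀ ℂ) (Φ : ℝ →ₗ[ℚ] ℝ) : ℂ :=
  q.sum fun l z => z * Complex.exp (Complex.I * (Φ l : ℂ))

/-- The finitely supported function `l ↦ W(l) c(l)`. -/
def hadamard (W : ℝ →₀ ℂ) (c : ℝ → ℂ) : ℝ →₀ ℂ :=
  Finsupp.onFinset W.support (fun l => W l * c l) fun l hl => by
    rw [Finsupp.mem_support_iff]
    exact left_ne_zero_of_mul hl

@[simp]
theorem hadamard_apply (W : ℝ →₀ ℂ) (c : ℝ → ℂ) (l : ℝ) : hadamard W c l = W l * c l := rfl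

theorem hadamard_sum (W : ℝ →₀ ℂ) (c : ℝ → ℂ) (e : ℝ → ℂ) :
    ((hadamard W c).sum fun l z => z * e l) = ∑ l ∈ W.support, W l * c l * e l :=
  Finsupp.onFinset_sum _ fun l => by simp

theorem charSum_hadamard (W : ℝ →₀ ℂ) (c : ℝ → ℂ) (Φ : ℝ →ₗ[ℚ] ℝ) :
    charSum (hadamard W c) Φ = ∑ l ∈ W.support, W l * c l * Complex.exp (Complex.I * (Φ l : ℂ)) :=
  hadamard_sum _ _ _

theorem expPoly_hadamard (W : ℝ →₀ ℂ) (c : ℝ → ℂ) (s : ℂ) :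
    expPoly (hadamard W c) s = ∑ l ∈ W.support, W l * c l * Complex.exp (l * s) :=
  hadamard_sum W c fun l => Complex.exp (l * s)

theorem charSum_add (p q : ℝ →₀ ℂ) (Φ : ℝ →ₗ[ℚ] ℝ) :
    charSum (p + q) Φ = charSum p Φ + charSum q Φ :=
  Finsupp.sum_add_index' (by simp) (by intros; ring)

theorem charSum_finsetSum {κ : Type*} (s : Finset κ) (p : κ → ℝ →₀ ℂ) (Φ : ℝ →ₗ[ℚ] ℝ) :
    charSum (∑ i ∈ s, p i) Φ = ∑ i ∈ s, charSum (p i) Φ :=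
  (Finsupp.sum_finsetSum_index (by simp) (by intros; ring)).symm

theorem charSum_single (l : ℝ) (z : ℂ) (Φ : ℝ →ₗ[ℚ] ℝ) :
    charSum (Finsupp.single l z) Φ = z * Complex.exp (Complex.I * (Φ l : ℂ)) :=
  Finsupp.sum_single_index (by simp)

/-- On a vertical line the factor `e^{lσ}` goes into the coefficients, leaving evaluation at the
character of `t`. -/
theorem expPoly_eq_charSum (q : ℝ →₀ ℂ) (σ t : ℝ) :
    expPoly q (σ + t * Complex.I) =
      charSum (hadamard q fun l => Complex.exp (l * σ)) (LinearMap.mulLeft ℚ t) := by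
  rw [charSum_hadamard, expPoly, Finsupp.sum]
  refine Finset.sum_congr rfl fun l _ => ?_
  rw [mul_assoc, ← Complex.exp_add]
  simp only [LinearMap.mulLeft_apply]
  push_cast
  ring_nf

/-- A trigonometric polynomial of mean value `1` which is nonnegative at all characters. -/
structure IsPosKernel (W : ℝ →₀ ℂ) : Prop where
  apply_zero : W 0 = 1
  nonneg : ∀ Φ : ℝ →ₗ[ℚ] ℝ, ∃ r : ℝ, 0 ≤ r ∧ charSum W Φ = r

theorem charSum_sub_mulLeft (W : ℝ →₀ ℂ) (Φ : ℝ →ₗ[ℚ] ℝ) (t : ℝ) :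
    charSum W (Φ - LinearMap.mulLeft ℚ t) =
      ∑ l ∈ W.support, W l * Complex.exp (Complex.I * (Φ l : ℂ)) *
        Complex.exp (Complex.I * ((-l) * t : ℝ)) := by
  refine Finset.sum_congr rfl fun l _ => ?_
  rw [mul_assoc, ← Complex.exp_add]
  simp only [LinearMap.sub_apply, LinearMap.mulLeft_apply]
  push_cast
  ring_nf

/-- Convolution with a positive kernel of mean `1` does not increase the supremum norm. -/
theorem IsPosKernel.norm_charSum_le {W : ℝ →₀ ℂ} (hW : IsPosKernel W) {h : ℝ → ℂ} {c : ℝ → ℂ}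
    {C : ℝ} (h_cont : Continuous h) (h_le : ∀ t, ‖h t‖ ≤ C)
    (hc : ∀ l ∈ W.support, HasMean (fun t => h t * Complex.exp (Complex.I * ((-l) * t : ℝ))) (c l))
    (Φ : ℝ →ₗ[ℚ] ℝ) : ‖charSum (hadamard W c) Φ‖ ≤ C := by
  have hC : 0 ≤ C := (norm_nonneg _).trans (h_le 0)
  -- The shift is by the character `Φ`, so the mean of `h * K` is the filtered sum at `Φ`; since `K
  -- ≥ 0` has mean `W 0 = 1`, comparison with `C * K` gives the bound.
  set K : ℝ → ℂ := fun t => charSum W (Φ - LinearMap.mulLeft ℚ t) with hK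
  have hK_cont : Continuous K := by
    simp only [hK, charSum_sub_mulLeft]
    fun_prop
  have hK_re : ∀ t, ((K t).re : ℂ) = K t ∧ 0 ≤ (K t).re := by
    intro t
    obtain ⟨r, hr, h⟩ := hW.nonneg (Φ - LinearMap.mulLeft ℚ t)
    simp [hK, h, hr]
  have hK_mean : HasMean K 1 := by
    have := HasMean.sum W.support
      (h := fun l t => W l * Complex.exp (Complex.I * (Φ l : ℂ)) *
        Complex.exp (Complex.I * ((-l) * t : ℝ)))
      (fun l _ => (hasMean_exp (-l)).const_mul (W l * Complex.exp (Complex.I * (Φ l : ℂ))))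
      (fun l _ => by fun_prop)
    simp only [← charSum_sub_mulLeft] at this
    convert! this
    simp [Finset.sum_ite_eq', hW.apply_zero]
  have hhK : HasMean (fun t => h t * K t) (charSum (hadamard W c) Φ) := by
    have := HasMean.sum W.support
      (h := fun l t => W l * Complex.exp (Complex.I * (Φ l : ℂ)) *
        (h t * Complex.exp (Complex.I * ((-l) * t : ℝ))))
      (fun l hl => (hc l hl).const_mul (W l * Complex.exp (Complex.I * (Φ l : ℂ))))
      (fun l _ => by fun_prop)
    convert! this using 2
    · rename_i t
      simp only [hK, charSum_sub_mulLeft, Finset.mul_sum]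
      refine Finset.sum_congr rfl fun l _ => ?_
      ring
    · rw [charSum_hadamard]
      refine Finset.sum_congr rfl fun l _ => ?_
      ring
  have hb : HasMean (fun t => ((C * (K t).re : ℝ) : ℂ)) (C * 1) := by
    convert! hK_mean.const_mul (C : ℂ) using 2
    rename_i t
    rw [Complex.ofReal_mul, (hK_re t).1]
  refine (hhK.norm_le (by fun_prop) hb fun t => ?_).trans ?_
  · rw [norm_mul, ← (hK_re t).1, Complex.norm_real, Real.norm_of_nonneg (hK_re t).2,
      Complex.ofReal_re]
    exact mul_le_mul_of_nonneg_right (h_le t) (hK_re t).2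
  · rw [mul_one, Complex.norm_real, Real.norm_of_nonneg hC]

/-! ### Fejér kernels -/

theorem sum_Icc_neg_succ (n : ℕ) (h : ℤ → ℂ) :
    ∑ j ∈ Finset.Icc (-((n + 1 : ℕ) : ℤ)) ((n + 1 : ℕ) : ℤ), h j =
      ∑ j ∈ Finset.Icc (-(n : ℤ)) n, h j + (h (n + 1) + h (-(n + 1))) := by
  have : Finset.Icc (-((n + 1 : ℕ) : ℤ)) ((n + 1 : ℕ) : ℤ) =
      insert ((n : ℤ) + 1) (insert (-((n : ℤ) + 1)) (Finset.Icc (-(n : ℤ)) n)) := by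
    ext j
    simp only [Finset.mem_Icc, Finset.mem_insert]
    push_cast
    omega
  rw [this, Finset.sum_insert (by simp; omega), Finset.sum_insert (by simp)]
  ring

theorem sum_Icc_neg (n : ℕ) (h : ℤ → ℂ) :
    ∑ j ∈ Finset.Icc (-(n : ℤ)) n, h j =
      h 0 + ∑ m ∈ Finset.range n, (h (m + 1) + h (-(m + 1))) := by
  induction n with
  | zero => simp
  | succ n ih => rw [sum_Icc_neg_succ, ih, Finset.sum_range_succ, add_assoc]

/-- The difference `j` arises from `n + 1 - |j|` pairs; this turns the squared modulus of a
geometric sum into a Fejér sum. -/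
theorem sum_range_sub (n : ℕ) (h : ℤ → ℂ) :
    ∑ a ∈ Finset.range (n + 1), ∑ b ∈ Finset.range (n + 1), h (a - b) =
      ∑ j ∈ Finset.Icc (-(n : ℤ)) n, ((n : ℂ) + 1 - |(j : ℝ)|) * h j := by
  induction n with
  | zero => simp
  | succ n ih =>
    -- All weights grow by one and the old weight vanishes at `|j| = n + 1`, so the increment is the
    -- plain sum over `|j| ≤ n + 1`: the new row and column of the square.
    have h1 : ∑ j ∈ Finset.Icc (-((n + 1 : ℕ) : ℤ)) ((n + 1 : ℕ) : ℤ),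
        (((n + 1 : ℕ) : ℂ) + 1 - |(j : ℝ)|) * h j =
        ∑ j ∈ Finset.Icc (-((n + 1 : ℕ) : ℤ)) ((n + 1 : ℕ) : ℤ), ((n : ℂ) + 1 - |(j : ℝ)|) * h j +
        ∑ j ∈ Finset.Icc (-((n + 1 : ℕ) : ℤ)) ((n + 1 : ℕ) : ℤ), h j := by
      rw [← Finset.sum_add_distrib]
      refine Finset.sum_congr rfl fun j _ => ?_
      push_cast
      ring
    have h2 : |(n : ℝ) + 1| = n + 1 := abs_of_nonneg (by positivity)
    have h3 : |-1 + -(n : ℝ)| = n + 1 := by rw [← h2, ← abs_neg]; ring_nf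
    rw [h1, sum_Icc_neg_succ, ← ih, sum_Icc_neg, Finset.sum_add_distrib, Finset.sum_range_succ]
    simp only [Finset.sum_range_succ _ (n + 1), Finset.sum_add_distrib]
    rw [← Finset.sum_range_reflect (fun m : ℕ => h ((m : ℤ) + 1)),
      ← Finset.sum_range_reflect (fun m : ℕ => h (-((m : ℤ) + 1)))]
    have e1 : ∀ m ∈ Finset.range (n + 1), h (((n + 1 - 1 - m : ℕ) : ℤ) + 1) =
        h (((n + 1 : ℕ) : ℤ) - m) := by
      intro m hm
      have := Finset.mem_range.1 hm
      congr 1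
      omega
    have e2 : ∀ m ∈ Finset.range (n + 1), h (-(((n + 1 - 1 - m : ℕ) : ℤ) + 1)) =
        h ((m : ℤ) - ((n + 1 : ℕ) : ℤ)) := by
      intro m hm
      have := Finset.mem_range.1 hm
      congr 1
      omega
    rw [Finset.sum_congr rfl e1, Finset.sum_congr rfl e2]
    push_cast
    simp [h2, h3]
    ring

/-- The sum is `|∑_{a ≤ n} e^{iaθ}|² / (n + 1)`. -/
theorem fejer_nonneg (n : ℕ) (θ : ℝ) :
    ∃ r : ℝ, 0 ≤ r ∧ ∑ j ∈ Finset.Icc (-(n : ℤ)) n,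
      ((1 - |(j : ℝ)| / ((n : ℝ) + 1) : ℝ) : ℂ) * Complex.exp (Complex.I * (j * θ : ℝ)) = r := by
  refine ⟨‖∑ a ∈ Finset.range (n + 1), Complex.exp (Complex.I * (a * θ : ℝ))‖ ^ 2 / (n + 1),
    by positivity, ?_⟩
  have hn : (n : ℂ) + 1 ≠ 0 := by exact_mod_cast n.succ_ne_zero
  push_cast
  rw [eq_div_iff hn, ← Complex.mul_conj', map_sum, Finset.sum_mul_sum, Finset.sum_mul]
  have := sum_range_sub n fun j => Complex.exp (Complex.I * (j * θ : ℝ))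
  push_cast at this
  convert this.symm using 1
  · refine Finset.sum_congr rfl fun j _ => ?_
    field_simp
  · refine Finset.sum_congr rfl fun a _ => Finset.sum_congr rfl fun b _ => ?_
    rw [← Complex.exp_conj, ← Complex.exp_add]
    simp
    ring_nf

variable {ι : Type*}

/-- The Fejér weight of the integer vector `r`. -/
def fejerProd (I : Finset ι) (n : ι → ℕ) (r : ι →₀ ℤ) : ℝ :=
  ∏ k ∈ I, (1 - |(r k : ℝ)| / ((n k : ℝ) + 1))

/-- The real number `∑ k, r_k g_k`. -/
def intComb (g : ι → ℝ) (r : ι →₀ ℤ) : ℝ := r.sum fun k m => (m : ℝ) * g k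

/-- The Bochner-Fejér kernel for the frequencies `g_k`, `k ∈ I`, and orders `n_k + 1`. -/
def fejerKernel (g : ι → ℝ) (I : Finset ι) (n : ι → ℕ) : ℝ →₀ ℂ :=
  ∑ r ∈ I.finsupp fun k => Finset.Icc (-(n k : ℤ)) (n k),
    Finsupp.single (intComb g r) (fejerProd I n r : ℂ)

theorem map_intComb (g : ι → ℝ) (r : ι →₀ ℤ) (Φ : ℝ →ₗ[ℚ] ℝ) :
    Φ (intComb g r) = intComb (fun k => Φ (g k)) r := by
  simp only [intComb, Finsupp.sum, map_sum]
  refine Finset.sum_congr rfl fun k _ => ?_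
  rw [← zsmul_eq_mul, ← zsmul_eq_mul, map_zsmul]

/-- Characters turn integral combinations into products, so the kernel factors into one-dimensional
Fejér sums. Independence of the `g k` plays no role here; it matters only for reading off
coefficients. -/
theorem charSum_fejerKernel (g : ι → ℝ) (I : Finset ι) (n : ι → ℕ) (Φ : ℝ →ₗ[ℚ] ℝ) :
    charSum (fejerKernel g I n) Φ = ∏ k ∈ I, ∑ j ∈ Finset.Icc (-(n k : ℤ)) (n k),
      ((1 - |(j : ℝ)| / ((n k : ℝ) + 1) : ℝ) : ℂ) *
        Complex.exp (Complex.I * (j * Φ (g k) : ℝ)) := by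
  classical
  rw [Finset.prod_sum, fejerKernel, charSum_finsetSum, Finset.finsupp, Finset.sum_map]
  refine Finset.sum_congr (by congr!) fun p _ => ?_
  simp only [Function.Embedding.coeFn_mk]
  rw [charSum_single, map_intComb, Finset.prod_mul_distrib, ← Complex.exp_sum, ← Finset.mul_sum]
  congr 1
  · rw [fejerProd, Complex.ofReal_prod, ← Finset.prod_attach]
    refine Finset.prod_congr rfl fun k _ => ?_
    simp
  · rw [intComb, Finsupp.sum_of_support_subset _ (s := I) (Finsupp.support_indicator_subset _ _) _
      (by simp), ← Finset.sum_attach, Complex.ofReal_sum]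
    congr 2
    refine Finset.sum_congr rfl fun k _ => ?_
    simp

theorem intComb_injective {g : ι → ℝ} (hg : LinearIndependent ℚ g) :
    Function.Injective (intComb g) := by
  have hz : LinearIndependent ℤ g := (LinearIndependent.iff_fractionRing ℤ ℚ).2 hg
  intro r r' h
  refine hz ?_
  simpa [Finsupp.linearCombination_apply, intComb] using h

theorem fejerKernel_apply {g : ι → ℝ} (hg : LinearIndependent ℚ g) (I : Finset ι) (n : ι → ℕ)
    (r : ι →₀ ℤ) [Decidable (r ∈ I.finsupp fun k => Finset.Icc (-(n k : ℤ)) (n k))] :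
    fejerKernel g I n (intComb g r) =
      if r ∈ I.finsupp fun k => Finset.Icc (-(n k : ℤ)) (n k) then (fejerProd I n r : ℂ) else 0 := by
  classical
  rw [fejerKernel, Finsupp.finsetSum_apply]
  simp only [Finsupp.single_apply, (intComb_injective hg).eq_iff]
  rw [Finset.sum_ite_eq']
  split_ifs <;> rfl

theorem isPosKernel_fejerKernel {g : ι → ℝ} (hg : LinearIndependent ℚ g) (I : Finset ι)
    (n : ι → ℕ) : IsPosKernel (fejerKernel g I n) := by
  classical
  refine ⟨?_, fun Φ => ?_⟩
  · have := fejerKernel_apply hg I n 0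
    rw [if_pos (by simp [Finset.mem_finsupp_iff])] at this
    simpa [intComb, fejerProd] using this
  · choose r hr h using fun k => fejer_nonneg (n k) (Φ (g k))
    refine ⟨∏ k ∈ I, r k, Finset.prod_nonneg fun k _ => hr k, ?_⟩
    rw [charSum_fejerKernel, Complex.ofReal_prod]
    exact Finset.prod_congr rfl fun k _ => h k

/-- Coordinates outside the support of `r` contribute the factor 1, so the weight is eventually a
fixed finite product of factors tending to 1. Only finitely many orders need to be large, which is
all that `Filter.pi` provides. -/
theorem tendsto_fejerKernel {g : ι → ℝ} (hg : LinearIndependent ℚ g) (r : ι →₀ ℤ) :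
    Tendsto (fun p : Finset ι × (ι → ℕ) => fejerKernel g p.1 p.2 (intComb g r))
      (IntegralBasis.fejerFilter ι) (𝓝 1) := by
  classical
  have hn : ∀ k, Tendsto (fun p : Finset ι × (ι → ℕ) => p.2 k) (IntegralBasis.fejerFilter ι)
      atTop := fun k => (tendsto_eval_pi _ k).comp tendsto_snd
  have h1 : ∀ᶠ p : Finset ι × (ι → ℕ) in IntegralBasis.fejerFilter ι, r.support ⊆ p.1 :=
    tendsto_fst.eventually (eventually_ge_atTop r.support)
  have h2 : ∀ᶠ p : Finset ι × (ι → ℕ) in IntegralBasis.fejerFilter ι,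
      ∀ k ∈ r.support, (r k).natAbs ≤ p.2 k :=
    (Filter.eventually_all_finset _).2 fun k _ => (hn k).eventually (eventually_ge_atTop _)
  have hlim : Tendsto (fun p : Finset ι × (ι → ℕ) =>
      ((∏ k ∈ r.support, (1 - |(r k : ℝ)| / ((p.2 k : ℝ) + 1)) : ℝ) : ℂ))
      (IntegralBasis.fejerFilter ι) (𝓝 ((1 : ℝ) : ℂ)) := by
    refine (Complex.continuous_ofReal.tendsto _).comp ?_
    have : ∀ k ∈ r.support, Tendsto (fun p : Finset ι × (ι → ℕ) =>
        1 - |(r k : ℝ)| / ((p.2 k : ℝ) + 1)) (IntegralBasis.fejerFilter ι) (𝓝 1) := by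
      intro k _
      have h3 : Tendsto (fun p : Finset ι × (ι → ℕ) => (p.2 k : ℝ) + 1)
          (IntegralBasis.fejerFilter ι) atTop :=
        tendsto_atTop_add_const_right _ _ (tendsto_natCast_atTop_atTop.comp (hn k))
      simpa using (h3.const_div_atTop |(r k : ℝ)|).const_sub 1
    simpa using tendsto_finsetProd r.support this
  rw [Complex.ofReal_one] at hlim
  refine hlim.congr' ?_
  filter_upwards [h1, h2] with p hp hp'
  rw [fejerKernel_apply hg, if_pos, fejerProd]
  · congr 1
    refine Finset.prod_subset hp fun k _ hk => ?_
    simp [Finsupp.notMem_support_iff.1 hk]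
  · refine Finset.mem_finsupp_iff.2 ⟨hp, fun k _ => ?_⟩
    rw [Finset.mem_Icc]
    by_cases hk : k ∈ r.support
    · have := hp' k hk
      omega
    · rw [Finsupp.notMem_support_iff.1 hk]
      omega

instance neBot_fejerFilter : (IntegralBasis.fejerFilter ι).NeBot := by
  classical
  unfold IntegralBasis.fejerFilter
  infer_instance

/-! ### Approximate identities and Kronecker's theorem -/

/-- Every finite set of reals consists of integral combinations of finitely many rationally
independent reals. -/
theorem exists_integral_generators (E : Finset ℝ) :
    ∃ (m : ℕ) (g : Fin m → ℝ), LinearIndependent ℚ g ∧ ∀ l ∈ E, ∃ r, intComb g r = l := by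
  have : Module.Finite ℤ (Submodule.span ℤ (E : Set ℝ)) :=
    Module.Finite.span_of_finite ℤ E.finite_toSet
  -- A finitely generated torsion-free group is free.
  let b := Module.finBasis ℤ (Submodule.span ℤ (E : Set ℝ))
  refine ⟨_, fun k => (b k : ℝ), ?_, fun l hl => ?_⟩
  · rw [← LinearIndependent.iff_fractionRing ℤ ℚ]
    exact b.linearIndependent.map' (Submodule.subtype _) (Submodule.ker_subtype _)
  · refine ⟨b.repr ⟨l, Submodule.subset_span hl⟩, ?_⟩
    have := congrArg Subtype.val (b.linearCombination_repr ⟨l, Submodule.subset_span hl⟩)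
    simpa [Finsupp.linearCombination_apply, intComb, Finsupp.sum] using this

/-- Approximants of an almost periodic function may have frequencies outside `Λ`, so the kernel is
built from generators of `E` itself. -/
theorem exists_isPosKernel_near_one (E : Finset ℝ) {δ : ℝ} (hδ : 0 < δ) :
    ∃ W : ℝ →₀ ℂ, IsPosKernel W ∧ ∀ l ∈ E, ‖W l - 1‖ ≤ δ := by
  obtain ⟨m, g, hg, hE⟩ := exists_integral_generators E
  have : ∀ᶠ p : Finset (Fin m) × (Fin m → ℕ) in IntegralBasis.fejerFilter (Fin m),
      ∀ l ∈ E, ‖fejerKernel g p.1 p.2 l - 1‖ ≤ δ := by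
    refine (Filter.eventually_all_finset _).2 fun l hl => ?_
    obtain ⟨r, rfl⟩ := hE l hl
    filter_upwards [Metric.tendsto_nhds.1 (tendsto_fejerKernel hg r) δ hδ] with p hp
    rw [← dist_eq_norm]
    exact hp.le
  obtain ⟨p, hp⟩ := this.exists
  exact ⟨_, isPosKernel_fejerKernel hg p.1 p.2, hp⟩

theorem continuous_charSum_mulLeft (q : ℝ →₀ ℂ) :
    Continuous fun t : ℝ => charSum q (LinearMap.mulLeft ℚ t) := by
  simp only [charSum, Finsupp.sum, LinearMap.mulLeft_apply]
  fun_prop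

theorem hasMean_charSum (q : ℝ →₀ ℂ) (l : ℝ) :
    HasMean (fun t => charSum q (LinearMap.mulLeft ℚ t) *
      Complex.exp (Complex.I * ((-l) * t : ℝ))) (q l) := by
  classical
  have := HasMean.sum q.support
    (h := fun m t => q m * Complex.exp (Complex.I * ((m - l) * t : ℝ)))
    (fun m _ => (hasMean_exp (m - l)).const_mul (q m)) (fun m _ => by fun_prop)
  convert this using 2
  · rw [charSum, Finsupp.sum, Finset.sum_mul]
    refine Finset.sum_congr rfl fun m _ => ?_
    rw [mul_assoc, ← Complex.exp_add]
    simp only [LinearMap.mulLeft_apply]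
    push_cast
    ring_nf
  · simp [sub_eq_zero]

theorem hadamard_comm (p q : ℝ →₀ ℂ) : hadamard p q = hadamard q p := by
  ext l
  simp [mul_comm]

/-- The supremum of an exponential sum over all characters is its supremum over the real line. -/
theorem norm_charSum_le_of_forall_mulLeft {q : ℝ →₀ ℂ} {C : ℝ}
    (hq : ∀ t : ℝ, ‖charSum q (LinearMap.mulLeft ℚ t)‖ ≤ C) (Φ : ℝ →ₗ[ℚ] ℝ) :
    ‖charSum q Φ‖ ≤ C := by
  refine le_of_forall_pos_le_add fun η hη => ?_
  set M := ∑ l ∈ q.support, ‖q l‖ with hM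
  have hM0 : 0 ≤ M := Finset.sum_nonneg fun _ _ => norm_nonneg _
  -- Replacing `q` by its filtered version then costs at most `η` at every character; `M + 1` avoids
  -- division by zero.
  obtain ⟨W, hW, hW1⟩ := exists_isPosKernel_near_one q.support (δ := η / (M + 1)) (by positivity)
  have h1 : ‖charSum (hadamard W q) Φ‖ ≤ C :=
    hW.norm_charSum_le (continuous_charSum_mulLeft q) hq (fun l _ => hasMean_charSum q l) Φ
  have h2 : ‖charSum (hadamard q fun l => 1 - W l) Φ‖ ≤ η := by
    rw [charSum_hadamard]
    refine (norm_sum_le _ _).trans ?_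
    have : ∀ l ∈ q.support, ‖q l * (1 - W l) * Complex.exp (Complex.I * (Φ l : ℂ))‖ ≤
        ‖q l‖ * (η / (M + 1)) := by
      intro l hl
      rw [norm_mul, norm_mul, mul_comm Complex.I, Complex.norm_exp_ofReal_mul_I, mul_one,
        norm_sub_rev]
      exact mul_le_mul_of_nonneg_left (hW1 l hl) (norm_nonneg _)
    refine (Finset.sum_le_sum this).trans ?_
    rw [← Finset.sum_mul, ← hM, mul_div_assoc', div_le_iff₀ (by positivity)]
    nlinarith
  have h3 : charSum q Φ = charSum (hadamard W q) Φ + charSum (hadamard q fun l => 1 - W l) Φ := by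
    rw [← charSum_add]
    congr 1
    ext l
    simp only [Finsupp.add_apply, hadamard_apply]
    ring
  rw [h3]
  exact (norm_add_le _ _).trans (add_le_add h1 h2)

/-- Nearly maximal modulus forces `|1 + z m| ≥ 2 - δ` for each term, and the parallelogram law gives
`|1 - z m|² = 4 - |1 + z m|²`. -/
theorem norm_sub_sq_le_of_le_norm_one_add_sum {E : Finset ℝ} {z : ℝ → ℂ} {δ : ℝ} (hδ : δ ≤ 1)
    (hz : ∀ m, ‖z m‖ = 1) (h : 1 + (E.card : ℝ) - δ ≤ ‖1 + ∑ m ∈ E, z m‖) {m : ℝ} (hm : m ∈ E) :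
    ‖1 - z m‖ ^ 2 ≤ 4 * δ := by
  classical
  have h1 : ‖∑ k ∈ E.erase m, z k‖ ≤ (E.card : ℝ) - 1 := by
    refine (norm_sum_le _ _).trans ?_
    simp [hz, Finset.card_erase_of_mem hm, Nat.cast_sub (Finset.card_pos.2 ⟨m, hm⟩)]
  have h2 : 1 + ∑ k ∈ E, z k = (1 + z m) + ∑ k ∈ E.erase m, z k := by
    rw [← Finset.add_sum_erase E z hm]
    ring
  have h3 : 2 - δ ≤ ‖1 + z m‖ := by
    have := norm_add_le (1 + z m) (∑ k ∈ E.erase m, z k)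
    rw [← h2] at this
    linarith
  have h4 := parallelogram_law_with_norm ℝ (1 : ℂ) (z m)
  rw [hz, norm_one] at h4
  nlinarith [sq_nonneg δ]

/-- **Kronecker's theorem**: on finite sets of frequencies, every character is approximated by the
characters `l ↦ e^{ilt}`. -/
theorem exists_forall_norm_exp_sub_le (E : Finset ℝ) (Φ : ℝ →ₗ[ℚ] ℝ) {ε : ℝ} (hε : 0 < ε) :
    ∃ t : ℝ, ∀ l ∈ E,
      ‖Complex.exp (Complex.I * (Φ l : ℂ)) - Complex.exp (Complex.I * (t * l : ℝ))‖ ≤ ε := by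
  set δ := min (ε ^ 2 / 4) 1 with hδ
  have hδ0 : 0 < δ := lt_min (by positivity) one_pos
  -- At `Φ` all terms of `p` equal 1, so its value `1 + |E|` must be nearly attained on the line;
  -- there every phase is close to that of `Φ`. The choice of `δ` ensures `4δ ≤ ε²`.
  set p : ℝ →₀ ℂ := Finsupp.single 0 1 +
    ∑ m ∈ E, Finsupp.single m (Complex.exp (Complex.I * ((-Φ m : ℝ) : ℂ))) with hp
  have hp_eval : ∀ Ψ : ℝ →ₗ[ℚ] ℝ, charSum p Ψ =
      1 + ∑ m ∈ E, Complex.exp (((Ψ m - Φ m : ℝ) : ℂ) * Complex.I) := by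
    intro Ψ
    rw [hp, charSum_add, charSum_finsetSum, charSum_single]
    simp only [charSum_single, ← Complex.exp_add, map_zero]
    congr 1
    · simp
    · refine Finset.sum_congr rfl fun m _ => ?_
      push_cast
      ring_nf
  obtain ⟨t, ht⟩ : ∃ t : ℝ, 1 + (E.card : ℝ) - δ ≤ ‖charSum p (LinearMap.mulLeft ℚ t)‖ := by
    by_contra! h
    have := norm_charSum_le_of_forall_mulLeft (fun t => (h t).le) Φ
    rw [hp_eval] at this
    simp only [sub_self, Complex.ofReal_zero, zero_mul, Complex.exp_zero, Finset.sum_const,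
      nsmul_eq_mul, mul_one] at this
    have h' : ‖(1 : ℂ) + E.card‖ = 1 + E.card := by
      rw [← Nat.cast_one, ← Nat.cast_add, Complex.norm_natCast]
      push_cast
      rfl
    linarith
  refine ⟨t, fun l hl => ?_⟩
  rw [hp_eval] at ht
  have := norm_sub_sq_le_of_le_norm_one_add_sum (min_le_right _ _)
    (fun m => Complex.norm_exp_ofReal_mul_I _) ht hl
  have h1 : Complex.exp (Complex.I * (Φ l : ℂ)) - Complex.exp (Complex.I * (t * l : ℝ)) =
      Complex.exp ((Φ l : ℝ) * Complex.I) *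
        (1 - Complex.exp (((LinearMap.mulLeft ℚ t l - Φ l : ℝ) : ℂ) * Complex.I)) := by
    rw [mul_sub, ← Complex.exp_add]
    simp only [LinearMap.mulLeft_apply]
    push_cast
    ring_nf
  rw [h1, norm_mul, Complex.norm_exp_ofReal_mul_I, one_mul]
  refine abs_le_of_sq_le_sq' ?_ hε.le |>.2
  have := min_le_left (ε ^ 2 / 4) 1
  linarith

theorem charSum_mem_closure (q : ℝ →₀ ℂ) (Φ : ℝ →ₗ[ℚ] ℝ) :
    charSum q Φ ∈ closure (Set.range fun t : ℝ => charSum q (LinearMap.mulLeft ℚ t)) := by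
  rw [Metric.mem_closure_range_iff]
  intro ε hε
  set M := ∑ l ∈ q.support, ‖q l‖ with hM
  have hM0 : 0 ≤ M := Finset.sum_nonneg fun _ _ => norm_nonneg _
  obtain ⟨t, ht⟩ := exists_forall_norm_exp_sub_le q.support Φ (ε := ε / (M + 1)) (by positivity)
  refine ⟨t, ?_⟩
  rw [dist_eq_norm, charSum, charSum, Finsupp.sum, Finsupp.sum, ← Finset.sum_sub_distrib]
  refine (norm_sum_le _ _).trans_lt ?_
  have : ∀ l ∈ q.support, ‖q l * Complex.exp (Complex.I * (Φ l : ℂ)) -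
      q l * Complex.exp (Complex.I * (LinearMap.mulLeft ℚ t l : ℂ))‖ ≤ ‖q l‖ * (ε / (M + 1)) := by
    intro l hl
    rw [← mul_sub, norm_mul]
    exact mul_le_mul_of_nonneg_left (ht l hl) (norm_nonneg _)
  refine (Finset.sum_le_sum this).trans_lt ?_
  rw [← Finset.sum_mul, ← hM, mul_div_assoc', div_lt_iff₀ (by positivity)]
  nlinarith

/-! ### Twisted exponential polynomials on vertical lines -/

/-- The character `l ↦ e^{i Ψ(l)}`. -/
def charVal (Ψ : ℝ →ₗ[ℚ] ℝ) (l : ℝ) : ℂ := Complex.exp (Complex.I * (Ψ l : ℂ))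

theorem norm_charVal (Ψ : ℝ →ₗ[ℚ] ℝ) (l : ℝ) : ‖charVal Ψ l‖ = 1 := by
  rw [charVal, mul_comm, Complex.norm_exp_ofReal_mul_I]

theorem charVal_mul_charVal_neg (Ψ : ℝ →ₗ[ℚ] ℝ) (l : ℝ) : charVal Ψ l * charVal (-Ψ) l = 1 := by
  rw [charVal, charVal, ← Complex.exp_add]
  simp

/-- Twisting and vertical translation combine by addition of linear maps. -/
theorem expPoly_hadamard_charVal (p : ℝ →₀ ℂ) (Ψ : ℝ →ₗ[ℚ] ℝ) (σ u : ℝ) :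
    expPoly (hadamard p (charVal Ψ)) (σ + u * Complex.I) =
      charSum (hadamard p fun l => Complex.exp (l * σ)) (Ψ + LinearMap.mulLeft ℚ u) := by
  rw [charSum_hadamard, expPoly_hadamard]
  refine Finset.sum_congr rfl fun l _ => ?_
  rw [mul_assoc, mul_assoc, charVal, ← Complex.exp_add, ← Complex.exp_add]
  simp only [LinearMap.add_apply, LinearMap.mulLeft_apply]
  push_cast
  ring_nf

theorem continuous_expPoly (q : ℝ →₀ ℂ) : Continuous (expPoly q) := by
  unfold expPoly Finsupp.sum
  fun_prop

theorem hasDirichletCoeff_expPoly (α β : EReal) (q : ℝ →₀ ℂ) (l : ℝ) :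
    HasDirichletCoeff α β (expPoly q) l (q l) := by
  intro σ _ _
  have := (hasMean_charSum (hadamard q fun l => Complex.exp (l * σ)) l).const_mul
    (Complex.exp (-(l * σ)))
  rw [hadamard_apply, mul_comm (q l), ← mul_assoc, ← Complex.exp_add, neg_add_cancel,
    Complex.exp_zero, one_mul] at this
  change HasMean _ _
  convert! this using 2
  rename_i t
  rw [expPoly_eq_charSum, mul_left_comm, ← Complex.exp_add]
  congr 2
  push_cast
  ring

theorem norm_expPoly_hadamard_sub_le {W q : ℝ →₀ ℂ} {δ R : ℝ}
    (hW : ∀ l ∈ q.support, ‖W l - 1‖ ≤ δ) {s : ℂ} (hs : |s.re| ≤ R) :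
    ‖expPoly (hadamard W q) s - expPoly q s‖ ≤ δ * ∑ l ∈ q.support, ‖q l‖ * Real.exp (|l| * R) := by
  rw [hadamard_comm, expPoly_hadamard, expPoly, Finsupp.sum, ← Finset.sum_sub_distrib,
    Finset.mul_sum]
  refine (norm_sum_le _ _).trans (Finset.sum_le_sum fun l hl => ?_)
  have h1 : q l * W l * Complex.exp (l * s) - q l * Complex.exp (l * s) =
      (W l - 1) * (q l * Complex.exp (l * s)) := by ring
  have h2 : ‖Complex.exp (l * s)‖ ≤ Real.exp (|l| * R) := by
    rw [Complex.norm_exp, Complex.re_ofReal_mul, Real.exp_le_exp]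
    exact (le_abs_self _).trans (by rw [abs_mul]; gcongr)
  rw [h1, norm_mul, norm_mul]
  have h3 := hW l hl
  have h4 := (norm_nonneg _).trans h3
  gcongr

/-- This is the contraction on the line through `s`, with coefficients rescaled by `e^{lσ}`, at the
character `Ψ` plus multiplication by `s.im`. -/
theorem IsPosKernel.norm_expPoly_le {W : ℝ →₀ ℂ} (hW : IsPosKernel W) {h : ℂ → ℂ} {c : ℝ → ℂ}
    {C : ℝ} {s : ℂ} (h_cont : Continuous fun t : ℝ => h (s.re + t * Complex.I))
    (h_le : ∀ t : ℝ, ‖h (s.re + t * Complex.I)‖ ≤ C)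
    (hc : ∀ l : ℝ, HasMean (fun t : ℝ => h (s.re + t * Complex.I) *
      Complex.exp (-(l * (s.re + t * Complex.I)))) (c l)) (Ψ : ℝ →ₗ[ℚ] ℝ) :
    ‖expPoly (hadamard W fun l => c l * charVal Ψ l) s‖ ≤ C := by
  have h1 : ∀ l ∈ W.support, HasMean (fun t : ℝ => h (s.re + t * Complex.I) *
      Complex.exp (Complex.I * ((-l) * t : ℝ))) (c l * Complex.exp (l * s.re)) := by
    intro l _
    have := (hc l).const_mul (Complex.exp (l * s.re))
    rw [mul_comm _ (c l)] at this
    convert! this using 2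
    rename_i t
    rw [mul_left_comm, ← Complex.exp_add]
    push_cast
    ring_nf
  have := hW.norm_charSum_le h_cont h_le h1 (Ψ + LinearMap.mulLeft ℚ s.im)
  rw [← Complex.re_add_im s]
  have e : hadamard W (fun l => c l * charVal Ψ l) = hadamard (hadamard W c) (charVal Ψ) := by
    ext l
    simp [mul_assoc]
  have e' : hadamard W (fun l => c l * Complex.exp (l * s.re)) =
      hadamard (hadamard W c) fun l => Complex.exp (l * s.re) := by
    ext l
    simp [mul_assoc]
  rwa [e, expPoly_hadamard_charVal, ← e']

/-! ### Almost periodic functions -/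

variable {α β : EReal} {f F : ℂ → ℂ} {c : ℝ → ℂ}

theorem IsAlmostPeriodicOn.continuous_line (hf : IsAlmostPeriodicOn α β f) {σ : ℝ}
    (hα : α < (σ : EReal)) (hβ : (σ : EReal) < β) :
    Continuous fun t : ℝ => f (σ + t * Complex.I) := by
  refine continuous_of_uniform_approx_of_continuous fun u hu => ?_
  obtain ⟨ε, hε, hu⟩ := Metric.mem_uniformity_dist.1 hu
  obtain ⟨q, hq⟩ := hf σ σ hα hβ ε hε
  refine ⟨fun t => expPoly q (σ + t * Complex.I), (continuous_expPoly q).comp (by fun_prop),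
    fun t => hu ?_⟩
  rw [dist_eq_norm]
  exact hq _ (by simp) (by simp)

theorem HasMean.sub {h k : ℝ → ℂ} {c d : ℂ} (hh : HasMean h c) (hk : HasMean k d)
    (h_cont : Continuous h) (k_cont : Continuous k) : HasMean (fun t => h t - k t) (c - d) := by
  simpa [sub_eq_add_neg] using hh.add (hk.const_mul (-1)) h_cont (by fun_prop)

theorem HasDirichletCoeff.hasMean_sub_expPoly (hf : IsAlmostPeriodicOn α β f) {l : ℝ} {z : ℂ}
    (hz : HasDirichletCoeff α β f l z) (q : ℝ →₀ ℂ) {σ : ℝ} (hα : α < (σ : EReal))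
    (hβ : (σ : EReal) < β) :
    HasMean (fun t : ℝ => (f (σ + t * Complex.I) - expPoly q (σ + t * Complex.I)) *
      Complex.exp (-(l * (σ + t * Complex.I)))) (z - q l) := by
  have h1 := hf.continuous_line hα hβ
  have h2 : Continuous fun t : ℝ => expPoly q (σ + t * Complex.I) :=
    (continuous_expPoly q).comp (by fun_prop)
  simp only [sub_mul]
  exact HasMean.sub (hz σ hα hβ) (hasDirichletCoeff_expPoly α β q l σ hα hβ)
    (h1.mul (by fun_prop)) (h2.mul (by fun_prop))

/-- The strip version of the contraction property of positive kernels. -/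
theorem IsPosKernel.norm_expPoly_sub_le {W : ℝ →₀ ℂ} (hW : IsPosKernel W)
    (hf : IsAlmostPeriodicOn α β f) (hc : ∀ l, HasDirichletCoeff α β f l (c l)) {q : ℝ →₀ ℂ} {C : ℝ}
    {s : ℂ} (hα : α < (s.re : EReal)) (hβ : (s.re : EReal) < β)
    (hq : ∀ s' : ℂ, s'.re = s.re → ‖f s' - expPoly q s'‖ ≤ C) (Ψ : ℝ →ₗ[ℚ] ℝ) :
    ‖expPoly (hadamard W fun l => c l * charVal Ψ l) s -
      expPoly (hadamard W (hadamard q (charVal Ψ))) s‖ ≤ C := by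
  have h2 : Continuous fun t : ℝ => expPoly q (s.re + t * Complex.I) :=
    (continuous_expPoly q).comp (by fun_prop)
  have := hW.norm_expPoly_le (h := fun s => f s - expPoly q s) (c := fun l => c l - q l) (C := C)
    (s := s) ((hf.continuous_line hα hβ).sub h2) (fun t => hq _ (by simp))
    (fun l => (hc l).hasMean_sub_expPoly hf q hα hβ) Ψ
  convert! this using 2
  rw [expPoly_hadamard, expPoly_hadamard, expPoly_hadamard, ← Finset.sum_sub_distrib]
  refine Finset.sum_congr rfl fun l _ => ?_
  rw [hadamard_apply]
  ring

/-- Almost periodic functions are approximated by exponential polynomials whose frequencies are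
among those of the function. -/
theorem IsAlmostPeriodicOn.exists_expPoly_of_coeff (hf : IsAlmostPeriodicOn α β f)
    (hc : ∀ l, HasDirichletCoeff α β f l (c l)) {σ₁ σ₂ : ℝ} (h₁ : α < (σ₁ : EReal))
    (h₂ : (σ₂ : EReal) < β) {ε : ℝ} (hε : 0 < ε) :
    ∃ q : ℝ →₀ ℂ, (∀ l, c l = 0 → q l = 0) ∧
      ∀ s : ℂ, σ₁ ≤ s.re → s.re ≤ σ₂ → ‖f s - expPoly q s‖ ≤ ε := by
  obtain ⟨q, hq⟩ := hf σ₁ σ₂ h₁ h₂ (ε / 3) (by positivity)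
  set R := max |σ₁| |σ₂| with hR
  set M := ∑ l ∈ q.support, ‖q l‖ * Real.exp (|l| * R) with hM
  have hM0 : 0 ≤ M := Finset.sum_nonneg fun _ _ => by positivity
  obtain ⟨W, hW, hW1⟩ := exists_isPosKernel_near_one q.support (δ := ε / 3 / (M + 1))
    (by positivity)
  -- The filtered series of `f` has only frequencies of `f`. By contraction it is close to the
  -- filtered `q`, which is close to `q`, hence to `f`.
  refine ⟨hadamard W c, fun l hl => by simp [hl], fun s hs₁ hs₂ => ?_⟩
  have e1 := hq s hs₁ hs₂
  have e2 : ‖expPoly (hadamard W q) s - expPoly q s‖ ≤ ε / 3 := by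
    refine (norm_expPoly_hadamard_sub_le hW1 (abs_le_max_abs_abs hs₁ hs₂)).trans ?_
    rw [← hM, div_mul_eq_mul_div, div_le_iff₀ (by positivity)]
    nlinarith
  have e3 : ‖expPoly (hadamard W c) s - expPoly (hadamard W q) s‖ ≤ ε / 3 := by
    have := hW.norm_expPoly_sub_le hf hc (q := q) (C := ε / 3) (s := s)
      (h₁.trans_le (by exact_mod_cast hs₁)) (lt_of_le_of_lt (by exact_mod_cast hs₂) h₂)
      (fun s' hs' => (hq s' (by rwa [hs']) (by rwa [hs'])).le) 0
    convert! this using 4 <;> ext l <;> simp [charVal]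
  have : f s - expPoly (hadamard W c) s = (f s - expPoly q s) -
      (expPoly (hadamard W q) s - expPoly q s) -
      (expPoly (hadamard W c) s - expPoly (hadamard W q) s) := by ring
  rw [this]
  refine (norm_sub_le _ _).trans ((add_le_add (norm_sub_le _ _) le_rfl).trans ?_)
  linarith

/-- `F` arises from `f` by twisting its frequencies by the character `e^{iΨ}`: on reduced strips,
`f` and `F` have simultaneous approximations by an exponential polynomial and its twist. -/
def IsTwist (α β : EReal) (f F : ℂ → ℂ) (Ψ : ℝ →ₗ[ℚ] ℝ) : Prop :=
  ∀ σ₁ σ₂ : ℝ, α < (σ₁ : EReal) → (σ₂ : EReal) < β → ∀ ε : ℝ, 0 < ε →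
    ∃ q : ℝ →₀ ℂ, ∀ s : ℂ, σ₁ ≤ s.re → s.re ≤ σ₂ →
      ‖f s - expPoly q s‖ ≤ ε ∧ ‖F s - expPoly (hadamard q (charVal Ψ)) s‖ ≤ ε

namespace IsTwist

variable {Ψ : ℝ →ₗ[ℚ] ℝ}

theorem isAlmostPeriodicOn (h : IsTwist α β f F Ψ) : IsAlmostPeriodicOn α β F := by
  intro σ₁ σ₂ h₁ h₂ ε hε
  obtain ⟨q, hq⟩ := h σ₁ σ₂ h₁ h₂ (ε / 2) (by positivity)
  exact ⟨_, fun s hs₁ hs₂ => ((hq s hs₁ hs₂).2).trans_lt (by linarith)⟩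

theorem eq_of_zero (h : IsTwist α β f F 0) {s : ℂ} (hα : α < (s.re : EReal))
    (hβ : (s.re : EReal) < β) : F s = f s := by
  refine eq_of_forall_dist_le fun ε hε => ?_
  obtain ⟨q, hq⟩ := h s.re s.re hα hβ (ε / 2) (by positivity)
  obtain ⟨h1, h2⟩ := hq s le_rfl le_rfl
  have : hadamard q (charVal 0) = q := by ext l; simp [charVal]
  rw [this] at h2
  rw [← dist_eq_norm] at h1 h2
  linarith [dist_triangle_right (F s) (f s) (expPoly q s)]

/-- `F` is close to the twisted `q`, whose value Kronecker's theorem approximates by a value of `q`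
elsewhere on the line, where `q` is close to `f`. -/
theorem mem_closure_lineImage (h : IsTwist α β f F Ψ) {σ : ℝ} (hα : α < (σ : EReal))
    (hβ : (σ : EReal) < β) (u : ℝ) : F (σ + u * Complex.I) ∈ closure (lineImage f σ) := by
  rw [Metric.mem_closure_iff]
  intro ε hε
  obtain ⟨q, hq⟩ := h σ σ hα hβ (ε / 4) (by positivity)
  have h1 := (hq (σ + u * Complex.I) (by simp) (by simp)).2
  have h2 := charSum_mem_closure (hadamard q fun l => Complex.exp (l * σ))
    (Ψ + LinearMap.mulLeft ℚ u)
  rw [← expPoly_hadamard_charVal, Metric.mem_closure_range_iff] at h2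
  obtain ⟨t, ht⟩ := h2 (ε / 4) (by positivity)
  rw [← expPoly_eq_charSum] at ht
  refine ⟨f (σ + t * Complex.I), ⟨t, rfl⟩, ?_⟩
  have h3 := (hq (σ + t * Complex.I) (by simp) (by simp)).1
  rw [← dist_eq_norm] at h1 h3
  have h4 := dist_triangle4_right (F (σ + u * Complex.I)) (f (σ + t * Complex.I))
    (expPoly (hadamard q (charVal Ψ)) (σ + u * Complex.I)) (expPoly q (σ + t * Complex.I))
  linarith

end IsTwist

/-- A uniform error bounds the error of the averages for every `T > 0` at once. -/
theorem HasMean.of_approx {h : ℝ → ℂ} {c : ℂ} (h_cont : Continuous h)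
    (H : ∀ η : ℝ, 0 < η → ∃ (k : ℝ → ℂ) (z : ℂ), Continuous k ∧ HasMean k z ∧ ‖z - c‖ ≤ η ∧
      ∀ t, ‖h t - k t‖ ≤ η) : HasMean h c := by
  rw [HasMean, Metric.tendsto_nhds]
  intro ε hε
  obtain ⟨k, z, k_cont, hk, hz, hhk⟩ := H (ε / 4) (by positivity)
  filter_upwards [Metric.tendsto_nhds.1 hk (ε / 4) (by positivity), eventually_gt_atTop 0]
    with T hT hT0
  have h1 : ‖((2 * T : ℝ) : ℂ)⁻¹ * (∫ t in (-T)..T, h t) -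
      ((2 * T : ℝ) : ℂ)⁻¹ * ∫ t in (-T)..T, k t‖ ≤ ε / 4 := by
    rw [← mul_sub, ← intervalIntegral.integral_sub (h_cont.intervalIntegrable _ _)
      (k_cont.intervalIntegrable _ _), norm_mul, norm_inv, Complex.norm_real,
      Real.norm_of_nonneg (by positivity), inv_mul_le_iff₀ (by positivity)]
    refine (intervalIntegral.norm_integral_le_of_norm_le_const fun t _ => hhk t).trans_eq ?_
    rw [abs_of_nonneg (by linarith)]
    ring
  rw [← dist_eq_norm] at h1 hz
  have h2 := dist_triangle4 (((2 * T : ℝ) : ℂ)⁻¹ * ∫ t in (-T)..T, h t)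
    (((2 * T : ℝ) : ℂ)⁻¹ * ∫ t in (-T)..T, k t) z c
  linarith

theorem IsTwist.hasDirichletCoeff {Ψ : ℝ →ₗ[ℚ] ℝ} (h : IsTwist α β f F Ψ)
    (hf : IsAlmostPeriodicOn α β f) {l : ℝ} {z : ℂ} (hz : HasDirichletCoeff α β f l z) :
    HasDirichletCoeff α β F l (z * charVal Ψ l) := by
  intro σ hα hβ
  have hexp : ∀ t : ℝ, ‖Complex.exp (-(l * (σ + t * Complex.I)))‖ = Real.exp (-(l * σ)) := by
    intro t
    rw [Complex.norm_exp]
    simp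
  have hF_cont := h.isAlmostPeriodicOn.continuous_line hα hβ
  refine HasMean.of_approx (hF_cont.mul (by fun_prop)) fun η hη => ?_
  -- `e^{-ls}` has constant modulus `e^{-lσ}` on the line; dividing by it makes the weighted error
  -- `η`.
  obtain ⟨q, hq⟩ := h σ σ hα hβ (η / Real.exp (-(l * σ))) (by positivity)
  have hcancel : η / Real.exp (-(l * σ)) * Real.exp (-(l * σ)) = η :=
    div_mul_cancel₀ _ (Real.exp_pos _).ne'
  have hq_cont : ∀ p : ℝ →₀ ℂ, Continuous fun t : ℝ => expPoly p (σ + t * Complex.I) :=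
    fun p => (continuous_expPoly p).comp (by fun_prop)
  have := hq_cont (hadamard q (charVal Ψ))
  refine ⟨_, _, ?_, hasDirichletCoeff_expPoly α β (hadamard q (charVal Ψ)) l σ hα hβ, ?_, ?_⟩
  · fun_prop
  · rw [hadamard_apply, ← sub_mul, norm_mul, norm_charVal, mul_one, norm_sub_rev]
    have := (hz.hasMean_sub_expPoly hf q hα hβ).norm_le (b := fun _ => η) continuous_const
      (hasMean_const (η : ℂ)) fun t => ?_
    · rwa [Complex.norm_real, Real.norm_of_nonneg hη.le] at this
    · rw [norm_mul, hexp, ← hcancel]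
      exact mul_le_mul_of_nonneg_right (hq _ (by simp) (by simp)).1 (Real.exp_pos _).le
  · intro t
    rw [← sub_mul, norm_mul, hexp, ← hcancel]
    exact mul_le_mul_of_nonneg_right (hq _ (by simp) (by simp)).2 (Real.exp_pos _).le

/-! ### Bochner-Fejér summation -/

namespace IntegralBasis

variable {Λ : Set ℝ} (G : IntegralBasis Λ ι)

theorem intComb_coord (l : Λ) : intComb G.g (G.coord l) = l := G.coord_sum l

/-- The kernel stops at `|r_k| ≤ n k`, exactly where the factor with order `n k + 1` is positive, so
the truncation `max 0` agrees with the cutoff. -/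
theorem fejerKernel_coe (I : Finset ι) (n : ι → ℕ) (l : Λ) :
    fejerKernel G.g I n (l : ℝ) = (G.fejerWeight I n l : ℂ) := by
  classical
  rw [← G.intComb_coord l, fejerKernel_apply G.linearIndependent, fejerWeight]
  have key : ∀ k, G.coord l k ∈ Finset.Icc (-(n k : ℤ)) (n k) ↔
      |(G.coord l k : ℝ)| < (n k : ℝ) + 1 := by
    intro k
    rw [Finset.mem_Icc, ← abs_le, ← Int.cast_abs]
    have : |G.coord l k| < (n k : ℤ) + 1 ↔ ((|G.coord l k| : ℤ) : ℝ) < (n k : ℝ) + 1 := by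
      exact_mod_cast Iff.rfl
    rw [← this, Int.lt_add_one_iff]
  by_cases hs : (G.coord l).support ⊆ I
  · rw [if_pos hs]
    by_cases hr : ∀ k ∈ I, G.coord l k ∈ Finset.Icc (-(n k : ℤ)) (n k)
    · rw [if_pos (Finset.mem_finsupp_iff.2 ⟨hs, hr⟩), fejerProd]
      congr 1
      refine Finset.prod_congr rfl fun k hk => (max_eq_right ?_).symm
      rw [sub_nonneg]
      exact div_le_one_of_le₀ ((key k).1 (hr k hk)).le (by positivity)
    · rw [if_neg fun h => hr (Finset.mem_finsupp_iff.1 h).2]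
      push Not at hr
      obtain ⟨k, hk, hkr⟩ := hr
      rw [key, not_lt] at hkr
      rw [Finset.prod_eq_zero hk, Complex.ofReal_zero]
      rw [max_eq_left]
      rw [sub_nonpos, one_le_div (by positivity)]
      exact hkr
  · rw [if_neg hs, if_neg fun h => hs (Finset.mem_finsupp_iff.1 h).1, Complex.ofReal_zero]

theorem bochnerFejerPoly_eq_expPoly {b : Λ → ℂ} (hb : ∀ l : Λ, c l = b l)
    (hc : ∀ l ∉ Λ, c l = 0) (I : Finset ι) (n : ι → ℕ) (s : ℂ) :
    G.bochnerFejerPoly b I n s = expPoly (hadamard (fejerKernel G.g I n) c) s := by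
  have h1 : G.bochnerFejerPoly b I n s =
      ∑ᶠ l : Λ, fejerKernel G.g I n (l : ℝ) * c l * Complex.exp ((l : ℝ) * s) :=
    finsum_congr fun l => by rw [fejerKernel_coe, hb]
  rw [h1, expPoly_hadamard, finsum_subtype_eq_finsum_cond (· ∈ Λ)
    (f := fun l : ℝ => fejerKernel G.g I n l * c l * Complex.exp (l * s))]
  have h2 : ∀ l : ℝ, ∑ᶠ _ : l ∈ Λ, fejerKernel G.g I n l * c l * Complex.exp (l * s) =
      fejerKernel G.g I n l * c l * Complex.exp (l * s) := by
    intro l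
    by_cases hl : l ∈ Λ
    · simp [hl]
    · simp [hl, hc l hl]
  rw [finsum_congr h2]
  refine finsum_eq_sum_of_support_subset _ fun l hl => ?_
  rw [Finset.mem_coe, Finsupp.mem_support_iff]
  exact left_ne_zero_of_mul (left_ne_zero_of_mul hl)

/-- The Bochner-Fejér polynomials of a twist are close to the twists of approximations. -/
theorem eventually_norm_sub_le (hf : IsAlmostPeriodicOn α β f)
    (hc : ∀ l, HasDirichletCoeff α β f l (c l)) {q : ℝ →₀ ℂ} (hq0 : ∀ l ∉ Λ, q l = 0)
    {σ₁ σ₂ : ℝ} (h₁ : α < (σ₁ : EReal)) (h₂ : (σ₂ : EReal) < β) {ε : ℝ} (hε : 0 < ε)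
    (hq : ∀ s : ℂ, σ₁ ≤ s.re → s.re ≤ σ₂ → ‖f s - expPoly q s‖ ≤ ε) (Ψ : ℝ →ₗ[ℚ] ℝ) :
    ∀ᶠ p : Finset ι × (ι → ℕ) in fejerFilter ι, ∀ s : ℂ, σ₁ ≤ s.re → s.re ≤ σ₂ →
      ‖expPoly (hadamard (fejerKernel G.g p.1 p.2) fun l => c l * charVal Ψ l) s -
        expPoly (hadamard q (charVal Ψ)) s‖ ≤ 2 * ε := by
  set Q := hadamard q (charVal Ψ) with hQ
  set R := max |σ₁| |σ₂| with hR
  set M := ∑ l ∈ Q.support, ‖Q l‖ * Real.exp (|l| * R) with hM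
  have hM0 : 0 ≤ M := Finset.sum_nonneg fun _ _ => by positivity
  have : ∀ᶠ p : Finset ι × (ι → ℕ) in fejerFilter ι,
      ∀ l ∈ Q.support, ‖fejerKernel G.g p.1 p.2 l - 1‖ ≤ ε / (M + 1) := by
    refine (Filter.eventually_all_finset _).2 fun l hl => ?_
    -- Frequencies in `Λ` have integer coordinates in `G`, so the weights tend to 1 there.
    have hlΛ : l ∈ Λ := by
      by_contra h
      exact (Finsupp.mem_support_iff.1 hl) (by simp [hQ, hq0 l h])
    have := tendsto_fejerKernel G.linearIndependent (G.coord ⟨l, hlΛ⟩)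
    rw [intComb_coord] at this
    filter_upwards [Metric.tendsto_nhds.1 this (ε / (M + 1)) (by positivity)] with p hp
    rw [← dist_eq_norm]
    exact hp.le
  filter_upwards [this] with p hp s hs₁ hs₂
  have e1 := (isPosKernel_fejerKernel G.linearIndependent p.1 p.2).norm_expPoly_sub_le hf hc
    (q := q) (C := ε) (s := s) (h₁.trans_le (by exact_mod_cast hs₁))
    (lt_of_le_of_lt (by exact_mod_cast hs₂) h₂)
    (fun s' hs' => hq s' (by rwa [hs']) (by rwa [hs'])) Ψ
  have e2 : ‖expPoly (hadamard (fejerKernel G.g p.1 p.2) Q) s - expPoly Q s‖ ≤ ε := by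
    refine (norm_expPoly_hadamard_sub_le hp (abs_le_max_abs_abs hs₁ hs₂)).trans ?_
    rw [← hM, div_mul_eq_mul_div, div_le_iff₀ (by positivity)]
    nlinarith
  refine (norm_sub_le_norm_sub_add_norm_sub _ _ _).trans ((add_le_add e1 e2).trans_eq ?_)
  ring

/-- The Bochner-Fejér sums of a twisted Dirichlet series converge, and their sum is a twist. -/
theorem exists_isTwist (hf : IsAlmostPeriodicOn α β f)
    (hc : ∀ l, HasDirichletCoeff α β f l (c l)) (hc0 : ∀ l ∉ Λ, c l = 0) (Ψ : ℝ →ₗ[ℚ] ℝ) :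
    ∃ F : ℂ → ℂ, IsTwist α β f F Ψ ∧ ∀ s : ℂ, α < (s.re : EReal) → (s.re : EReal) < β →
      Tendsto (fun p : Finset ι × (ι → ℕ) =>
        expPoly (hadamard (fejerKernel G.g p.1 p.2) fun l => c l * charVal Ψ l) s)
        (fejerFilter ι) (𝓝 (F s)) := by
  set P : ℂ → Finset ι × (ι → ℕ) → ℂ := fun s p =>
    expPoly (hadamard (fejerKernel G.g p.1 p.2) fun l => c l * charVal Ψ l) s with hP
  have key : ∀ s : ℂ, ∃ w : ℂ, α < (s.re : EReal) → (s.re : EReal) < β →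
      Tendsto (P s) (fejerFilter ι) (𝓝 w) := by
    intro s
    by_cases h : α < (s.re : EReal) ∧ (s.re : EReal) < β
    swap
    · exact ⟨0, fun h1 h2 => absurd ⟨h1, h2⟩ h⟩
    suffices Cauchy (map (P s) (fejerFilter ι)) by
      obtain ⟨w, hw⟩ := CompleteSpace.complete this
      exact ⟨w, fun _ _ => hw⟩
    rw [Metric.cauchy_iff]
    refine ⟨inferInstance, fun ε hε => ?_⟩
    -- One fixed `q` traps all late sums in a ball of radius `2ε/5`.
    obtain ⟨q, hq0, hq⟩ := hf.exists_expPoly_of_coeff hc h.1 h.2 (ε := ε / 5) (by positivity)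
    have := G.eventually_norm_sub_le hf hc (fun l hl => hq0 l (hc0 l hl)) h.1 h.2
      (by positivity) hq Ψ
    refine ⟨Metric.closedBall (expPoly (hadamard q (charVal Ψ)) s) (2 * (ε / 5)), ?_, ?_⟩
    · rw [mem_map]
      filter_upwards [this] with p hp
      rw [Set.mem_preimage, Metric.mem_closedBall, dist_eq_norm]
      exact hp s le_rfl le_rfl
    · intro x hx y hy
      rw [Metric.mem_closedBall] at hx hy
      linarith [dist_triangle_right x y (expPoly (hadamard q (charVal Ψ)) s)]
  choose F hF using key
  refine ⟨F, fun σ₁ σ₂ h₁ h₂ ε hε => ?_, hF⟩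
  obtain ⟨q, hq0, hq⟩ := hf.exists_expPoly_of_coeff hc h₁ h₂ (ε := ε / 2) (by positivity)
  refine ⟨q, fun s hs₁ hs₂ => ⟨(hq s hs₁ hs₂).trans (by linarith), ?_⟩⟩
  have hlim := hF s (h₁.trans_le (by exact_mod_cast hs₁))
    (lt_of_le_of_lt (by exact_mod_cast hs₂) h₂)
  refine le_of_tendsto (hlim.sub_const _).norm ?_
  filter_upwards [G.eventually_norm_sub_le hf hc (fun l hl => hq0 l (hc0 l hl)) h₁ h₂
    (by positivity) hq Ψ] with p hp
  exact (hp s hs₁ hs₂).trans_eq (by ring)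

/-- Almost periodic functions are determined by their Dirichlet series. -/
theorem eq_of_coeff (G : IntegralBasis Λ ι) (hf : IsAlmostPeriodicOn α β f) (hF : IsAlmostPeriodicOn α β F)
    (hc : ∀ l, HasDirichletCoeff α β f l (c l)) (hc' : ∀ l, HasDirichletCoeff α β F l (c l))
    (hc0 : ∀ l ∉ Λ, c l = 0) {s : ℂ} (hα : α < (s.re : EReal)) (hβ : (s.re : EReal) < β) :
    F s = f s := by
  -- Both functions are limits of the same Bochner-Fejér sums, with the trivial twist.
  obtain ⟨f', hf', hf''⟩ := G.exists_isTwist hf hc hc0 0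
  obtain ⟨F', hF', hF''⟩ := G.exists_isTwist hF hc' hc0 0
  rw [← hf'.eq_of_zero hα hβ, ← hF'.eq_of_zero hα hβ]
  exact tendsto_nhds_unique (hF'' s hα hβ) (hf'' s hα hβ)

/-- The twist constructed by summation has the coefficients of `F`, so uniqueness identifies the two
on the strip. -/
theorem isTwist_of_coeff (G : IntegralBasis Λ ι) (hf : IsAlmostPeriodicOn α β f) (hF : IsAlmostPeriodicOn α β F)
    (hc : ∀ l, HasDirichletCoeff α β f l (c l)) (hc0 : ∀ l ∉ Λ, c l = 0) (Ψ : ℝ →ₗ[ℚ] ℝ)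
    (hc' : ∀ l, HasDirichletCoeff α β F l (c l * charVal Ψ l)) : IsTwist α β f F Ψ := by
  obtain ⟨F', hF', -⟩ := G.exists_isTwist hf hc hc0 Ψ
  intro σ₁ σ₂ h₁ h₂ ε hε
  obtain ⟨q, hq⟩ := hF' σ₁ σ₂ h₁ h₂ ε hε
  refine ⟨q, fun s hs₁ hs₂ => ⟨(hq s hs₁ hs₂).1, ?_⟩⟩
  rw [G.eq_of_coeff hF'.isAlmostPeriodicOn hF (fun l => hF'.hasDirichletCoeff hf (hc l)) hc'
    (fun l hl => by rw [hc0 l hl, zero_mul]) (h₁.trans_le (by exact_mod_cast hs₁))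
    (lt_of_le_of_lt (by exact_mod_cast hs₂) h₂)]
  exact (hq s hs₁ hs₂).2

/-- Values on independent elements are free, and a `ℚ`-linear map on a subspace extends to `ℝ`; thus
every `x` comes from a character. -/
theorem exists_linearMap (x : ι → ℝ) : ∃ Ψ : ℝ →ₗ[ℚ] ℝ, ∀ k, Ψ (G.g k) = x k := by
  obtain ⟨Ψ, hΨ⟩ := LinearMap.exists_extend ((Module.Basis.span G.linearIndependent).constr ℚ x)
  refine ⟨Ψ, fun k => ?_⟩
  have h1 := LinearMap.congr_fun hΨ (Module.Basis.span G.linearIndependent k)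
  rw [Module.Basis.constr_basis] at h1
  rw [← h1, LinearMap.comp_apply, Submodule.subtype_apply, Module.Basis.span_apply]

theorem pairing_eq (Ψ : ℝ →ₗ[ℚ] ℝ) (l : Λ) : G.pairing l (fun k => Ψ (G.g k)) = Ψ l := by
  have := map_intComb G.g (G.coord l) Ψ
  rw [intComb_coord] at this
  exact this.symm

theorem twist_eq (a : Λ → ℂ) (Ψ : ℝ →ₗ[ℚ] ℝ) (l : Λ) :
    G.twist a (fun k => Ψ (G.g k)) l = a l * charVal Ψ l := by
  rw [twist, pairing_eq, charVal]

/-- Adding `t * g k` to each `x k` multiplies the term at `l` by `e^{ilt}`. -/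
theorem bochnerFejerPoly_twist_line (a : Λ → ℂ) (Ψ : ℝ →ₗ[ℚ] ℝ) (I : Finset ι) (n : ι → ℕ)
    (σ t : ℝ) :
    G.bochnerFejerPoly (G.twist a fun k => (Ψ + LinearMap.mulLeft ℚ t) (G.g k)) I n σ =
      G.bochnerFejerPoly (G.twist a fun k => Ψ (G.g k)) I n (σ + t * Complex.I) := by
  refine finsum_congr fun l => ?_
  rw [twist_eq, twist_eq, mul_assoc, mul_assoc, mul_assoc, mul_assoc, charVal, charVal,
    ← Complex.exp_add, ← Complex.exp_add]
  simp only [LinearMap.add_apply, LinearMap.mulLeft_apply]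
  push_cast
  ring_nf

end IntegralBasis

/-! ### Equivalent functions -/

section Series

variable {Λ : Set ℝ}

open Classical in
/-- The extension of a family of coefficients by zero. -/
def extendCoeff (a : Λ → ℂ) (l : ℝ) : ℂ := if h : l ∈ Λ then a ⟨l, h⟩ else 0

theorem extendCoeff_coe (a : Λ → ℂ) (l : Λ) : extendCoeff a l = a l := by
  simp [extendCoeff]

theorem extendCoeff_of_notMem (a : Λ → ℂ) {l : ℝ} (hl : l ∉ Λ) : extendCoeff a l = 0 := by
  simp [extendCoeff, hl]

theorem hasDirichletSeries_iff {a : Λ → ℂ} :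
    HasDirichletSeries α β f a ↔ ∀ l, HasDirichletCoeff α β f l (extendCoeff a l) := by
  refine ⟨fun h l => ?_, fun h => ⟨fun l => ?_, fun l hl => ?_⟩⟩
  · by_cases hl : l ∈ Λ
    · simpa [extendCoeff, hl] using h.1 ⟨l, hl⟩
    · simpa [extendCoeff, hl] using h.2 l hl
  · simpa [extendCoeff] using h l
  · simpa [extendCoeff, hl] using h l

theorem extendCoeff_mul_charVal {a b : Λ → ℂ} {Ψ : ℝ →ₗ[ℚ] ℝ}
    (h : ∀ l : Λ, b l = a l * charVal Ψ l) (l : ℝ) :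
    extendCoeff b l = extendCoeff a l * charVal Ψ l := by
  by_cases hl : l ∈ Λ
  · simpa [extendCoeff, hl] using h ⟨l, hl⟩
  · simp [extendCoeff, hl]

theorem coeffEquiv_iff {a b : Λ → ℂ} :
    CoeffEquiv a b ↔ ∃ Ψ : ℝ →ₗ[ℚ] ℝ, ∀ l : Λ, b l = a l * charVal Ψ l := by
  constructor
  · rintro ⟨ψ, h⟩
    obtain ⟨Ψ, rfl⟩ := ψ.exists_extend
    exact ⟨Ψ, h⟩
  · rintro ⟨Ψ, h⟩
    exact ⟨Ψ.comp (Submodule.subtype _), h⟩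

theorem mul_charVal_neg {a b : Λ → ℂ} {Ψ : ℝ →ₗ[ℚ] ℝ} (h : ∀ l : Λ, b l = a l * charVal Ψ l)
    (l : Λ) : a l = b l * charVal (-Ψ) l := by
  rw [h, mul_assoc, charVal_mul_charVal_neg, mul_one]

theorem HasDirichletSeries.unique {a b : Λ → ℂ} (ha : HasDirichletSeries α β f a)
    (hb : HasDirichletSeries α β f b) {σ : ℝ} (hα : α < (σ : EReal)) (hβ : (σ : EReal) < β) :
    a = b :=
  funext fun l => tendsto_nhds_unique (ha.1 l σ hα hβ) (hb.1 l σ hα hβ)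

theorem IntegralBasis.isTwist_of_hasDirichletSeries (G : IntegralBasis Λ ι) {a b : Λ → ℂ}
    (hf : IsAlmostPeriodicOn α β f) (hF : IsAlmostPeriodicOn α β F)
    (ha : HasDirichletSeries α β f a) (hb : HasDirichletSeries α β F b) {Ψ : ℝ →ₗ[ℚ] ℝ}
    (h : ∀ l : Λ, b l = a l * charVal Ψ l) : IsTwist α β f F Ψ := by
  refine G.isTwist_of_coeff hf hF (hasDirichletSeries_iff.1 ha)
    (fun l hl => extendCoeff_of_notMem a hl) Ψ fun l => ?_
  rw [← extendCoeff_mul_charVal h]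
  exact hasDirichletSeries_iff.1 hb l

theorem IntegralBasis.exists_twist (G : IntegralBasis Λ ι) {a : Λ → ℂ}
    (hf : IsAlmostPeriodicOn α β f) (ha : HasDirichletSeries α β f a) (Ψ : ℝ →ₗ[ℚ] ℝ) :
    ∃ F : ℂ → ℂ, IsAlmostPeriodicOn α β F ∧
      HasDirichletSeries α β F (G.twist a fun k => Ψ (G.g k)) ∧
      ∀ s : ℂ, α < (s.re : EReal) → (s.re : EReal) < β →
        G.BochnerFejerSummable (G.twist a fun k => Ψ (G.g k)) s (F s) := by
  have hc := hasDirichletSeries_iff.1 ha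
  have hc0 : ∀ l ∉ Λ, extendCoeff a l = 0 := fun l hl => extendCoeff_of_notMem a hl
  obtain ⟨F, hF, hlim⟩ := G.exists_isTwist hf hc hc0 Ψ
  refine ⟨F, hF.isAlmostPeriodicOn, hasDirichletSeries_iff.2 fun l => ?_, fun s hα hβ => ?_⟩
  · rw [extendCoeff_mul_charVal (G.twist_eq a Ψ)]
    exact hF.hasDirichletCoeff hf (hc l)
  · refine (hlim s hα hβ).congr fun p => (G.bochnerFejerPoly_eq_expPoly (fun l => ?_)
      (fun l hl => ?_) p.1 p.2 s).symm
    · rw [extendCoeff_coe, twist_eq]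
    · rw [hc0 l hl, zero_mul]

end Series

theorem IsTwist.lineImage_subset {Ψ : ℝ →ₗ[ℚ] ℝ} (h : IsTwist α β f F Ψ) {σ : ℝ}
    (hα : α < (σ : EReal)) (hβ : (σ : EReal) < β) :
    lineImage F σ ⊆ closure (lineImage f σ) := by
  rintro _ ⟨t, rfl⟩
  exact h.mem_closure_lineImage hα hβ t

end

/-! ### Images on the line and of the auxiliary function -/

theorem mainTheorem3 {Λ : Set ℝ} (hΛ : Λ.Countable) {ι : Type*} (G : IntegralBasis Λ ι)
    {α β : EReal} (f : ℂ → ℂ) (a : Λ → ℂ) (hf : IsAlmostPeriodicOn α β f)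
    (ha : HasDirichletSeries α β f a) (σ₀ : ℝ) (hα : α < (σ₀ : EReal)) (hβ : (σ₀ : EReal) < β) :
    (∀ f₁ : ℂ → ℂ, BohrEquiv Λ α β f₁ f →
      lineImage f₁ σ₀ ⊆ closure (lineImage f σ₀) ∧
      closure (lineImage f σ₀) = closure (lineImage f₁ σ₀)) ∧
    ((∀ x : ι → ℝ, G.BochnerFejerSummable (G.twist a x) (σ₀ : ℂ) (G.auxFun a σ₀ x)) ∧
      auxImage G a σ₀ = ⋃ f₂ ∈ {f₂ : ℂ → ℂ | BohrEquiv Λ α β f₂ f}, lineImage f₂ σ₀) := by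
  have hsum : ∀ (F : ℂ → ℂ) (x : ι → ℝ), G.BochnerFejerSummable (G.twist a x) (σ₀ : ℂ) (F σ₀) →
      G.auxFun a σ₀ x = F σ₀ := fun F x h => Tendsto.limUnder_eq h
  refine ⟨fun f₁ h => ?_, fun x => ?_, ?_⟩
  · obtain ⟨⟨hf₁, -⟩, -, a₁, b, ha₁, hb, hab⟩ := h
    obtain ⟨Ψ, hΨ⟩ := coeffEquiv_iff.1 hab
    have h1 := (G.isTwist_of_hasDirichletSeries hf₁ hf ha₁ hb hΨ).lineImage_subset hα hβ
    have h2 := (G.isTwist_of_hasDirichletSeries hf hf₁ hb ha₁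
      (mul_charVal_neg hΨ)).lineImage_subset hα hβ
    exact ⟨h2, (closure_minimal h1 isClosed_closure).antisymm
      (closure_minimal h2 isClosed_closure)⟩
  · obtain ⟨Ψ, hΨ⟩ := G.exists_linearMap x
    obtain rfl : (fun k => Ψ (G.g k)) = x := funext hΨ
    obtain ⟨F, -, -, hF⟩ := G.exists_twist hf ha Ψ
    have := hF σ₀ (by simpa using hα) (by simpa using hβ)
    rwa [hsum F _ this]
  · ext w
    simp only [Set.mem_iUnion, Set.mem_ofPred_eq, exists_prop]
    constructor
    · rintro ⟨x, rfl⟩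
      obtain ⟨Ψ, hΨ⟩ := G.exists_linearMap x
      obtain rfl : (fun k => Ψ (G.g k)) = x := funext hΨ
      obtain ⟨F, hF, hFa, hlim⟩ := G.exists_twist hf ha Ψ
      refine ⟨F, ⟨⟨hF, _, hFa⟩, ⟨hf, _, ha⟩, _, _, hFa, ha, coeffEquiv_iff.2
        ⟨-Ψ, mul_charVal_neg (G.twist_eq a Ψ)⟩⟩, 0, ?_⟩
      rw [hsum F _ (hlim σ₀ (by simpa using hα) (by simpa using hβ))]
      simp
    · rintro ⟨f₂, ⟨⟨hf₂, -⟩, -, a₂, b, ha₂, hb, hab⟩, t, rfl⟩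
      obtain rfl := hb.unique ha hα hβ
      obtain ⟨Ψ, hΨ⟩ := coeffEquiv_iff.1 hab
      -- The equivalence carries `f₂` to `f`, so `f₂` is the twist of `f` by `-Ψ`.
      obtain ⟨F, hF, hFa, hlim⟩ := G.exists_twist hf ha (-Ψ)
      have ha₂' : a₂ = G.twist b fun k => (-Ψ) (G.g k) := by
        ext l
        rw [G.twist_eq]
        exact mul_charVal_neg hΨ l
      rw [← ha₂'] at hFa
      have hre : ((σ₀ : ℂ) + t * Complex.I).re = σ₀ := by simp
      have h1 : α < ((((σ₀ : ℂ) + t * Complex.I).re : ℝ) : EReal) := by rwa [hre]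
      have h2 : ((((σ₀ : ℂ) + t * Complex.I).re : ℝ) : EReal) < β := by rwa [hre]
      -- The point for `f₂` at height zero is moved by `t` along the line.
      refine ⟨fun k => (-Ψ + LinearMap.mulLeft ℚ t) (G.g k), ?_⟩
      rw [G.eq_of_coeff hF hf₂ (hasDirichletSeries_iff.1 hFa) (hasDirichletSeries_iff.1 ha₂)
        (fun l hl => extendCoeff_of_notMem _ hl) h1 h2]
      refine (Tendsto.limUnder_eq ?_).symm
      exact (hlim _ h1 h2).congr fun p => (G.bochnerFejerPoly_twist_line b (-Ψ) p.1 p.2 σ₀ t).symm
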